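/- Let $\Omega\subset\mathbb C^n$ be a bounded domain (non-empty, open, connected) with $\mathcal C^2$-smooth boundary, i.e. every $p\in\partial\Omega$ has an open neighbourhood $U$ with a $\mathcal C^2$ function $\rho:U\to\mathbb R$, $d\rho\neq0$ on $U$, such that $\Omega\cap U=\{z\in U:\rho(z)<0\}$. Let $\Delta$ be the unit disc in $\mathbb C$. The Kobayashi pseudodistance $k_\Omega$ is the largest pseudodistance on $\Omega$ that does not exceed the Lempert function $$l_\Omega(z,w)=\inf\{\tanh^{-1}|\alpha| : \alpha\in\Delta,\ \exists\,\varphi\in\mathcal O(\Delta,\Omega),\ \varphi(0)=z,\ \varphi(\alpha)=w\},$$ the Kobayashi--Royden pseudometric is $$\kappa_\Omega(z;v)=\inf\{|\alpha| : \alpha\in\mathbb C,\ \exists\,\varphi\in\mathcal O(\Delta,\Omega),\ \varphi(0)=z,\ \alpha\varphi'(0)=v\},$$ and the length of an absolutely continuous curve $\gamma:[a,b]\to\Omega$ is $l^\kappa_\Omega(\gamma)=\int_a^b\kappa_\Omega(\gamma(t);\gamma'(t))\,dt$. For $\lambda\ge1$ and $\epsilon\ge0$, an absolutely continuous curve $\gamma:[0,l]\to\Omega$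 is a $(\lambda,\epsilon)$-geodesic if $$l^\kappa_\Omega(\gamma|_{[t_1,t_2]})\le\lambda\,k_\Omega(\gamma(t_1),\gamma(t_2))+\epsilon\qquad\text{for all }0\le t_1\le t_2\le l.$$ $\Omega$ has the $(\lambda,\epsilon)$-visibility property if for all distinct $p,q\in\partial\Omega$ there are neighbourhoods $U$ of $p$ and $V$ of $q$ and a compact set $K\subset\Omega$ such that every $(\lambda,\epsilon)$-geodesic $\gamma:[0,l]\to\Omega$ with $\gamma(0)\in\Omega\cap U$ and $\gamma(l)\in\Omega\cap V$ satisfies $\gamma([0,l])\cap K\neq\emptyset$. Suppose that either 1. $\Omega$ has the $(1,\epsilon)$-visibility property for some $\epsilon>0$; or 2. $\Omega$ has the $(\lambda,0)$-visibility property for every $\lambda>1$. Then $\Omega$ is pseudoconvex, i.e. there is a continuous plurisubharmonic function $u:\Omega\to\mathbb R$ such that $\{z\in\Omega:u(z)\le c\}$ is compact for every $c\in\mathbb R$. -/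

import Mathlib

open Set Metric MeasureTheory
open scoped ENNReal NNReal

noncomputable section

/-- Complex Euclidean space `ℂⁿ` with its Hermitian norm. -/
abbrev Cn (n : ℕ) : Type := EuclideanSpace ℂ (Fin n)

/-- `φ` restricts to a holomorphic map from the open unit disc of `ℂ` into `Ω`. -/
def IsHolomorphicDisc {n : ℕ} (Ω : Set (Cn n)) (φ : ℂ → Cn n) : Prop :=
  DifferentiableOn ℂ φ (ball 0 1) ∧ MapsTo φ (ball 0 1) Ω

/-- The Lempert function of `Ω`: the infimum of `artanh |α|` over all holomorphic discs `φ` in `Ω`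
and all `α` in the unit disc with `φ 0 = z`, `φ α = w` (it is `∞` if there are none). -/
def lempertFunction {n : ℕ} (Ω : Set (Cn n)) (z w : Cn n) : ℝ≥0∞ :=
  ⨅ (φ : ℂ → Cn n) (α : ℂ) (_ : IsHolomorphicDisc Ω φ ∧ α ∈ ball (0 : ℂ) 1 ∧ φ 0 = z ∧ φ α = w),
    ENNReal.ofReal (Real.artanh ‖α‖)

/-- `d` restricts to a (finite, nonnegative) pseudodistance on `Ω`. -/
structure IsPseudodistanceOn {n : ℕ} (Ω : Set (Cn n)) (d : Cn n → Cn n → ℝ≥0) : Prop where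
  self : ∀ x ∈ Ω, d x x = 0
  symm : ∀ x ∈ Ω, ∀ y ∈ Ω, d x y = d y x
  triangle : ∀ x ∈ Ω, ∀ y ∈ Ω, ∀ z ∈ Ω, d x z ≤ d x y + d y z

/-- The Kobayashi pseudodistance of `Ω`: the largest pseudodistance on `Ω` that does not exceed
the Lempert function, obtained as the pointwise supremum of all such pseudodistances. -/
def kobayashiDist {n : ℕ} (Ω : Set (Cn n)) (z w : Cn n) : ℝ≥0∞ :=
  ⨆ (d : Cn n → Cn n → ℝ≥0)
    (_ : IsPseudodistanceOn Ω d ∧ ∀ x ∈ Ω, ∀ y ∈ Ω, (d x y : ℝ≥0∞) ≤ lempertFunction Ω x y),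
    (d z w : ℝ≥0∞)

/-- The Kobayashi-Royden pseudometric of `Ω` at the point `z` in the direction `v`. -/
def kobayashiRoyden {n : ℕ} (Ω : Set (Cn n)) (z v : Cn n) : ℝ≥0∞ :=
  ⨅ (φ : ℂ → Cn n) (α : ℂ) (_ : IsHolomorphicDisc Ω φ ∧ φ 0 = z ∧ α • deriv φ 0 = v), ‖α‖ₑ

/-- The Kobayashi-Royden length of the restriction of the curve `γ` to `[a, b]`. -/
def kobayashiLength {n : ℕ} (Ω : Set (Cn n)) (γ : ℝ → Cn n) (a b : ℝ) : ℝ≥0∞ :=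
  ∫⁻ t in Icc a b, kobayashiRoyden Ω (γ t) (deriv γ t)

/-- The restriction of `γ` to `[0, l]` is a `(lam, ε)`-geodesic of `Ω`: an absolutely continuous
curve in `Ω` each of whose arcs has length at most `lam` times the Kobayashi distance of its
endpoints plus `ε`. -/
structure IsAlmostGeodesic {n : ℕ} (Ω : Set (Cn n)) (lam ε l : ℝ) (γ : ℝ → Cn n) : Prop where
  nonneg : 0 ≤ l
  mapsTo : MapsTo γ (Icc 0 l) Ω
  absolutelyContinuous : AbsolutelyContinuousOnInterval γ 0 l
  length_le : ∀ t₁ t₂ : ℝ, 0 ≤ t₁ → t₁ ≤ t₂ → t₂ ≤ l →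
    kobayashiLength Ω γ t₁ t₂ ≤
      ENNReal.ofReal lam * kobayashiDist Ω (γ t₁) (γ t₂) + ENNReal.ofReal ε

/-- The `(lam, ε)`-visibility property (for `1 ≤ lam` and `0 ≤ ε`). -/
def HasVisibility {n : ℕ} (Ω : Set (Cn n)) (lam ε : ℝ) : Prop :=
  ∀ p ∈ frontier Ω, ∀ q ∈ frontier Ω, p ≠ q →
    ∃ U ∈ nhds p, ∃ V ∈ nhds q, ∃ K : Set (Cn n), IsCompact K ∧ K ⊆ Ω ∧
      ∀ (l : ℝ) (γ : ℝ → Cn n), IsAlmostGeodesic Ω lam ε l γ →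
        γ 0 ∈ Ω ∩ U → γ l ∈ Ω ∩ V → (γ '' Icc 0 l ∩ K).Nonempty

/-- `Ω` has `C²`-smooth boundary: near each boundary point it is the negativity set of a
real-valued `C²` function without critical points. -/
def HasC2Boundary {n : ℕ} (Ω : Set (Cn n)) : Prop :=
  ∀ p ∈ frontier Ω, ∃ (U : Set (Cn n)) (ρ : Cn n → ℝ), IsOpen U ∧ p ∈ U ∧
    ContDiffOn ℝ 2 ρ U ∧ (∀ z ∈ U, fderiv ℝ ρ z ≠ 0) ∧ Ω ∩ U = {z ∈ U | ρ z < 0}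

/-- The continuous function `u` is plurisubharmonic on the open set `Ω`: it satisfies the
sub-mean value inequality on every closed affine complex disc contained in `Ω`. -/
def IsContinuousPsh {n : ℕ} (Ω : Set (Cn n)) (u : Cn n → ℝ) : Prop :=
  ContinuousOn u Ω ∧
    ∀ z w : Cn n, (∀ ζ ∈ closedBall (0 : ℂ) 1, z + ζ • w ∈ Ω) →
      u z ≤ Real.circleAverage (fun ζ : ℂ => u (z + ζ • w)) 0 1

/-- `Ω` is pseudoconvex: it has a continuous plurisubharmonic exhaustion function. -/
def IsPseudoconvex {n : ℕ} (Ω : Set (Cn n)) : Prop :=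
  ∃ u : Cn n → ℝ, IsContinuousPsh Ω u ∧ ∀ c : ℝ, IsCompact {z ∈ Ω | u z ≤ c}

end

open Filter Topology

/-! The function -log δ, with δ the distance to the complement, is a continuous exhaustion of Ω, so
the point is that it is plurisubharmonic. If the sub-mean value inequality fails on an affine disc,
pushing that disc towards a nearest boundary point gives a holomorphic disc ψ with ψ(0) = p ∈ ∂Ω
that enters Ω quadratically: δ(ψ(σ)) ≥ c|σ|² (`exists_inner_touching_disc`).

A C² boundary makes this stable. For x ∈ ∂Ω near p and a complex tangent vector w(x) near ψ'(0), a
small perturbation of ψ through x in direction w(x) stays in {ρ ≤ 0} on a disc of uniform radius r;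
translating by -tN, with N pointing outwards, puts it inside Ω. So κ_Ω(x - tN; w(x)) ≤ 1/r uniformly
in small t, and integrating the field w gives a boundary curve γ (`exists_isSlidingCurve`).

The translates γ - tN have arcs of Kobayashi length at most |s - s'|/r, while on a bounded domain
k_Ω is at least a multiple of the Euclidean distance, hence of |s - s'|. They are therefore
(λ,0)-geodesics for one large λ, and (1,ε)-geodesics once γ is short. As t → 0 they leave every
compact set while their endpoints tend to distinct boundary points, contradicting either form of
visibility (`IsSlidingCurve.not_hasVisibility`). -/

/-! ### Failure of the sub-mean value inequality in one variable -/

/-- On the unit circle, the real part of a trigonometric polynomial is the real part of an entire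
function. -/
lemma exists_entire_re_eq_of_mem_span_fourier {g : C(AddCircle (1 : ℝ), ℂ)}
    (hg : g ∈ Submodule.span ℂ (range (@fourier (1 : ℝ)))) :
    ∃ P : ℂ → ℂ, Differentiable ℂ P ∧ ∀ x, (g x).re = (P (AddCircle.toCircle x)).re := by
  -- Real parts do not commute with complex scalars; carrying `c` through the induction makes the
  -- scalar case work.
  suffices h : ∀ c : ℂ, ∃ P : ℂ → ℂ, Differentiable ℂ P ∧
      ∀ x, (c * g x).re = (P (AddCircle.toCircle x)).re by simpa using h 1
  induction hg using Submodule.span_induction with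
  | mem g hg =>
    obtain ⟨k, rfl⟩ := hg
    intro c
    obtain ⟨m, rfl | rfl⟩ := k.eq_nat_or_neg
    · exact ⟨fun z => c * z ^ m, by fun_prop, fun x => by
        simp [fourier_apply, AddCircle.toCircle_nsmul]⟩
    -- Conjugation preserves the real part and, on the circle, turns negative powers into positive
    -- ones.
    · refine ⟨fun z => (starRingEnd ℂ) c * z ^ m, by fun_prop, fun x => ?_⟩
      rw [← Complex.conj_re]
      simp only [fourier_apply, neg_smul, natCast_zsmul, AddCircle.toCircle_neg,
        AddCircle.toCircle_nsmul, Circle.coe_inv_eq_conj, Circle.coe_pow, map_mul, map_pow,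
        Complex.conj_conj]
  | zero => exact fun c => ⟨0, differentiable_const 0, by simp⟩
  | add g₁ g₂ _ _ h₁ h₂ =>
    intro c
    obtain ⟨P₁, hP₁, e₁⟩ := h₁ c
    obtain ⟨P₂, hP₂, e₂⟩ := h₂ c
    exact ⟨P₁ + P₂, hP₁.add hP₂, fun x => by
      simp only [ContinuousMap.add_apply, mul_add, Complex.add_re, e₁, e₂, Pi.add_apply]⟩
  | smul a g _ h =>
    intro c
    obtain ⟨P, hP, e⟩ := h (c * a)
    exact ⟨P, hP, fun x => by simpa [mul_assoc] using e x⟩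

/-- Continuous functions on the unit circle are uniform limits of real parts of entire functions. -/
lemma exists_entire_re_near_on_sphere {f : ℂ → ℝ} (hf : ContinuousOn f (sphere 0 1)) {ε : ℝ}
    (hε : 0 < ε) :
    ∃ P : ℂ → ℂ, Differentiable ℂ P ∧ ∀ z ∈ sphere (0 : ℂ) 1, |f z - (P z).re| < ε := by
  let g : C(AddCircle (1 : ℝ), ℂ) := ⟨fun x => (f (AddCircle.toCircle x) : ℂ), by
    refine Complex.continuous_ofReal.comp (hf.comp_continuous ?_ ?_)
    · exact continuous_subtype_val.comp AddCircle.continuous_toCircle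
    · intro x; exact mem_sphere_zero_iff_norm.2 (Circle.norm_coe _)⟩
  have hg : g ∈ (Submodule.span ℂ (range (@fourier (1 : ℝ)))).topologicalClosure := by
    rw [span_fourier_closure_eq_top]; trivial
  obtain ⟨q, hq, hgq⟩ := Metric.mem_closure_iff.1 hg ε hε
  obtain ⟨P, hP, e⟩ := exists_entire_re_eq_of_mem_span_fourier hq
  refine ⟨P, hP, fun z hz => ?_⟩
  obtain ⟨x, hx⟩ := (AddCircle.homeomorphCircle (T := (1 : ℝ)) one_ne_zero).surjective
    ⟨z, by simpa [Submonoid.unitSphere] using hz⟩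
  have hxz : ((AddCircle.toCircle x : Circle) : ℂ) = z := by
    rw [← AddCircle.homeomorphCircle_apply one_ne_zero, hx]
  have h1 : dist (g x) (q x) < ε := (ContinuousMap.dist_apply_le_dist x).trans_lt hgq
  rw [← hxz, ← e x]
  refine lt_of_le_of_lt ?_ h1
  rw [dist_eq_norm]
  simpa [g] using Complex.abs_re_le_norm (g x - q x)

/-- If a continuous function on the closed disc violates the sub-mean value inequality at the
centre, it is touched from above, at some interior point, by a strictly superharmonic function of
the form `Re F - c‖σ‖²` with `F` entire. -/
lemma exists_touching_of_circleAverage_lt {f : ℂ → ℝ} (hf : ContinuousOn f (closedBall 0 1))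
    (h : Real.circleAverage f 0 1 < f 0) :
    ∃ τ ∈ ball (0 : ℂ) 1, ∃ c > 0, ∃ F : ℂ → ℂ, Differentiable ℂ F ∧ F 0 = 0 ∧
      ∀ᶠ σ in 𝓝 (0 : ℂ), f (τ + σ) ≤ f τ + (F σ).re - c * ‖σ‖ ^ 2 := by
  set d := f 0 - Real.circleAverage f 0 1 with hd
  have hd0 : 0 < d := sub_pos.2 h
  have hfs : ContinuousOn f (sphere 0 1) := hf.mono sphere_subset_closedBall
  obtain ⟨P, hP, hfP⟩ := exists_entire_re_near_on_sphere hfs (show 0 < d / 8 by positivity)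
  have hcont : Continuous fun z => (P z).re := Complex.continuous_re.comp hP.continuous
  have hP0 : (P 0).re ≤ Real.circleAverage f 0 1 + d / 8 := by
    have h1 : Real.circleAverage (fun z => (P z).re) 0 1 = (P 0).re := by
      have h2 : Real.circleAverage P 0 1 = P 0 := DiffContOnCl.circleAverage hP.diffContOnCl
      have h3 := ContinuousLinearMap.circleAverage_comp_comm (f := P) (c := 0) (R := 1)
        Complex.reCLM hP.continuous.continuousOn.circleIntegrable'
      rw [h2] at h3
      exact h3
    have h4 : Real.circleAverage (fun z => (P z).re - d / 8) 0 1 ≤ Real.circleAverage f 0 1 := by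
      apply Real.circleAverage_mono
      · exact (hcont.sub continuous_const).continuousOn.circleIntegrable'
      · exact ContinuousOn.circleIntegrable' (by simpa using hfs)
      · intro z hz
        have := abs_lt.1 (hfP z (by simpa using hz))
        linarith
    have h5 : Real.circleAverage (fun z => (P z).re - d / 8) 0 1 = (P 0).re - d / 8 := by
      rw [← h1]
      have := Real.circleAverage_fun_sub (c := 0) (R := 1)
        (f₁ := fun z => (P z).re) (f₂ := fun _ => d / 8)
        hcont.continuousOn.circleIntegrable' continuous_const.continuousOn.circleIntegrable'
      rw [this, Real.circleAverage_const]
    linarith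
  -- On the circle v < 3d/8, whereas v(0) ≥ 7d/8, so the maximum of v is attained in the open disc.
  set v : ℂ → ℝ := fun z => f z - (P z).re + d / 4 * ‖z‖ ^ 2 with hv
  obtain ⟨τ, hτ, hmax⟩ := (isCompact_closedBall (0 : ℂ) 1).exists_isMaxOn
    ⟨0, by simp⟩ (show ContinuousOn v (closedBall 0 1) from
      (hf.sub hcont.continuousOn).add (by fun_prop))
  have hτ1 : τ ∈ ball (0 : ℂ) 1 := by
    by_contra hn
    have hs : ‖τ‖ = 1 := le_antisymm (by simpa using hτ) (by simpa using hn)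
    have h1 := abs_lt.1 (hfP τ (by simpa using hs))
    have h2 : v 0 ≤ v τ := hmax (by simp)
    simp only [hv, hs, norm_zero] at h2
    linarith
  -- F absorbs the increment of P and the linear term of |τ + σ|² = |τ|² + 2 Re(τ̄σ) + |σ|²; the
  -- |σ|² term remains as the strict gain.
  refine ⟨τ, hτ1, d / 4, by positivity,
    fun σ => P (τ + σ) - P τ - (d / 2 : ℝ) * (starRingEnd ℂ τ) * σ, by fun_prop, by simp, ?_⟩
  have hev : ∀ᶠ σ in 𝓝 (0 : ℂ), τ + σ ∈ ball (0 : ℂ) 1 := by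
    have : Tendsto (fun σ : ℂ => τ + σ) (𝓝 0) (𝓝 τ) := by
      simpa using (continuous_const.add continuous_id).tendsto (0 : ℂ) (f := fun σ : ℂ => τ + σ)
    exact this (isOpen_ball.mem_nhds hτ1)
  filter_upwards [hev] with σ hσ
  have h1 : v (τ + σ) ≤ v τ := hmax (ball_subset_closedBall hσ)
  simp only [hv] at h1
  have h2 : ‖τ + σ‖ ^ 2 = ‖τ‖ ^ 2 + 2 * ((starRingEnd ℂ τ) * σ).re + ‖σ‖ ^ 2 := by
    simp only [← Complex.normSq_eq_norm_sq, Complex.normSq_apply, Complex.add_re, Complex.add_im,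
      Complex.mul_re, Complex.conj_re, Complex.conj_im]
    ring
  have h3 : ((d / 2 : ℝ) * (starRingEnd ℂ τ) * σ).re = d / 2 * ((starRingEnd ℂ τ) * σ).re := by
    rw [mul_assoc, Complex.re_ofReal_mul]
  rw [Complex.sub_re, Complex.sub_re, h3]
  rw [h2] at h1
  linarith

/-! ### Euclidean lower bound for the Kobayashi distance -/

/-- From log y ≥ 1 - 1/y at y = (1+x)/(1-x), where the right side is 2x/(1+x) ≥ x. -/
lemma Real.half_le_artanh {x : ℝ} (h0 : 0 ≤ x) (h1 : x < 1) : x / 2 ≤ Real.artanh x := by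
  have h := Real.one_sub_inv_le_log_of_pos (show 0 < (1 + x) / (1 - x) from
    div_pos (by linarith) (by linarith))
  rw [Real.artanh_eq_half_log ⟨by linarith, h1.le⟩]
  have h2 : x ≤ 1 - ((1 + x) / (1 - x))⁻¹ := by
    rw [inv_div, le_sub_iff_add_le, ← le_sub_iff_add_le', div_le_iff₀ (by linarith)]
    nlinarith
  linarith

/-- The Kobayashi distance of a bounded set dominates a multiple of the Euclidean distance. -/
lemma exists_mul_dist_le_kobayashiDist {n : ℕ} {Ω : Set (Cn n)} (hbdd : Bornology.IsBounded Ω) :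
    ∃ m : ℝ, 0 < m ∧ ∀ x y : Cn n, ENNReal.ofReal (m * dist x y) ≤ kobayashiDist Ω x y := by
  obtain ⟨C, hC0, hC⟩ : ∃ C : ℝ, 0 < C ∧ ∀ x ∈ Ω, ∀ y ∈ Ω, dist x y ≤ C := by
    obtain ⟨C, hC⟩ := Metric.isBounded_iff.1 hbdd
    exact ⟨max C 1, by positivity, fun x hx y hy => (hC hx hy).trans (le_max_left _ _)⟩
  refine ⟨(2 * C)⁻¹, by positivity, fun x y => ?_⟩
  -- The scaled Euclidean distance competes in the supremum: by the Schwarz lemma, dist(φ(0), φ(α))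
  -- ≤ C|α| ≤ 2C artanh|α|.
  refine le_iSup₂_of_le (fun x y => Real.toNNReal ((2 * C)⁻¹ * dist x y)) ⟨⟨?_, ?_, ?_⟩, ?_⟩ le_rfl
  · simp
  · intro x _ y _; rw [dist_comm]
  · intro x _ y _ z _
    rw [← Real.toNNReal_add (by positivity) (by positivity), ← mul_add]
    gcongr
    exact dist_triangle _ _ _
  · intro x _ y _
    refine le_iInf fun φ => le_iInf fun α => le_iInf fun h => ?_
    obtain ⟨⟨hφ, hmap⟩, hα, rfl, rfl⟩ := h
    have h0 : (0 : ℂ) ∈ ball (0 : ℂ) 1 := by simp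
    have h1 := Complex.dist_le_div_mul_dist_of_mapsTo_ball (R₂ := C) hφ
      (fun z hz => hC _ (hmap hz) _ (hmap h0)) hα
    refine ENNReal.ofReal_le_ofReal ?_
    have h2 := Real.half_le_artanh (norm_nonneg α) (by simpa using hα)
    refine le_trans ?_ h2
    rw [inv_mul_le_iff₀ (by positivity), dist_comm]
    simp only [div_one, dist_zero_right] at h1
    linarith

/-! ### The inner touching disc -/

/-- If `-log dist(·, Ωᶜ)` violates the sub-mean value inequality on a closed affine disc in `Ω`,
then some holomorphic disc touches the boundary of `Ω` from inside to second order. -/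
lemma exists_inner_touching_disc {n : ℕ} {Ω : Set (Cn n)} (hopen : IsOpen Ω)
    (hne : Ωᶜ.Nonempty) {z w : Cn n} (hzw : ∀ ζ ∈ closedBall (0 : ℂ) 1, z + ζ • w ∈ Ω)
    (h : Real.circleAverage (fun ζ : ℂ => -Real.log (infDist (z + ζ • w) Ωᶜ)) 0 1
      < -Real.log (infDist z Ωᶜ)) :
    ∃ ψ : ℂ → Cn n, Differentiable ℂ ψ ∧ ψ 0 ∈ frontier Ω ∧
      ∃ c > 0, ∀ᶠ σ in 𝓝 (0 : ℂ), c * ‖σ‖ ^ 2 ≤ infDist (ψ σ) Ωᶜ := by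
  have hcl : IsClosed Ωᶜ := hopen.isClosed_compl
  have hpos : ∀ x, x ∈ Ω ↔ 0 < infDist x Ωᶜ := fun x => by
    rw [← hcl.notMem_iff_infDist_pos hne, notMem_compl_iff]
  obtain ⟨τ, hτ, c, hc, F, hF, hF0, htouch⟩ := exists_touching_of_circleAverage_lt
    (f := fun ζ : ℂ => -Real.log (infDist (z + ζ • w) Ωᶜ)) (by
      refine ContinuousOn.neg (ContinuousOn.log ?_ fun ζ hζ => ((hpos _).1 (hzw ζ hζ)).ne')
      exact ((continuous_infDist_pt _).comp (by fun_prop)).continuousOn) (by simpa using h)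
  set x := z + τ • w with hx
  have hxΩ : x ∈ Ω := hzw τ (ball_subset_closedBall hτ)
  have hδ : 0 < infDist x Ωᶜ := (hpos x).1 hxΩ
  obtain ⟨p, hp, hxp⟩ := hcl.exists_infDist_eq_dist hne x
  -- The point x + σw is moved by a vector of length δ(x)e^{-Re F}, whereas δ(x + σw) ≥ δ(x)e^{-Re
  -- F}e^{c|σ|²}; the surplus bounds δ(ψ(σ)) from below.
  let ψ : ℂ → Cn n := fun σ => x + σ • w + Complex.exp (-F σ) • (p - x)
  have hψ : Differentiable ℂ ψ := by fun_prop
  have hψ0 : ψ 0 = p := by simp [ψ, hF0]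
  have hev1 : ∀ᶠ σ in 𝓝 (0 : ℂ), x + σ • w ∈ Ω := by
    have : Tendsto (fun σ : ℂ => x + σ • w) (𝓝 0) (𝓝 x) := by
      have : Continuous (fun σ : ℂ => x + σ • w) := by fun_prop
      simpa using this.tendsto 0
    exact this (hopen.mem_nhds hxΩ)
  have hev2 : ∀ᶠ σ in 𝓝 (0 : ℂ), 1 / 2 < Real.exp (-(F σ).re) := by
    have hcont : Continuous fun σ => Real.exp (-(F σ).re) := by
      have := hF.continuous
      fun_prop
    have := hcont.tendsto 0
    simp only [hF0, Complex.zero_re, neg_zero, Real.exp_zero] at this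
    exact this (lt_mem_nhds (by norm_num))
  have hψd : ∀ᶠ σ in 𝓝 (0 : ℂ), infDist x Ωᶜ * c / 2 * ‖σ‖ ^ 2 ≤ infDist (ψ σ) Ωᶜ := by
    filter_upwards [hev1, hev2, htouch] with σ h1 h2 h3
    rw [show z + (τ + σ) • w = x + σ • w by rw [hx, add_smul, add_assoc]] at h3
    have h4 : infDist x Ωᶜ * Real.exp (-(F σ).re) * (1 + c * ‖σ‖ ^ 2) ≤
        infDist (x + σ • w) Ωᶜ := by
      rw [← Real.exp_log ((hpos _).1 h1)]
      calc infDist x Ωᶜ * Real.exp (-(F σ).re) * (1 + c * ‖σ‖ ^ 2)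
          ≤ infDist x Ωᶜ * Real.exp (-(F σ).re) * Real.exp (c * ‖σ‖ ^ 2) := by
            gcongr
            linarith [Real.add_one_le_exp (c * ‖σ‖ ^ 2)]
        _ = Real.exp (Real.log (infDist x Ωᶜ) + -(F σ).re + c * ‖σ‖ ^ 2) := by
            rw [Real.exp_add, Real.exp_add, Real.exp_log hδ]
        _ ≤ _ := Real.exp_le_exp.2 (by linarith)
    have h5 : infDist (x + σ • w) Ωᶜ ≤
        infDist (ψ σ) Ωᶜ + infDist x Ωᶜ * Real.exp (-(F σ).re) := by
      refine (infDist_le_infDist_add_dist (y := ψ σ)).trans_eq ?_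
      rw [dist_comm (x + σ • w), dist_eq_norm, hxp, dist_comm x, dist_eq_norm p]
      simp [ψ, norm_smul, Complex.norm_exp, mul_comm]
    have h6 : 0 ≤ infDist x Ωᶜ * (c * ‖σ‖ ^ 2) := by positivity
    nlinarith
  refine ⟨ψ, hψ, ?_, infDist x Ωᶜ * c / 2, by positivity, hψd⟩
  rw [hψ0, hopen.frontier_eq]
  refine ⟨?_, hp⟩
  have hlim : Tendsto ψ (𝓝[≠] 0) (𝓝 p) := by
    have := hψ.continuous.tendsto 0
    rw [hψ0] at this
    exact this.mono_left nhdsWithin_le_nhds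
  refine mem_closure_of_tendsto hlim ?_
  filter_upwards [hψd.filter_mono nhdsWithin_le_nhds, self_mem_nhdsWithin] with σ h1 h2
  have : σ ≠ 0 := h2
  exact (hpos _).2 (lt_of_lt_of_le (by positivity) h1)

/-! ### Second-order calculus -/

/-- The second derivative is nonpositive at a local maximum. -/
lemma IsLocalMax.second_deriv_nonpos {k k' : ℝ → ℝ} {k'' a : ℝ} (h : IsLocalMax k a)
    (hk : ∀ᶠ s in 𝓝 a, HasDerivAt k (k' s) s) (hk' : HasDerivAt k' k'' a) : k'' ≤ 0 := by
  by_contra! hpos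
  have hd : deriv k =ᶠ[𝓝 a] k' := hk.mono fun s hs => hs.deriv
  have hdd : deriv (deriv k) a = k'' := by rw [hd.deriv_eq, hk'.deriv]
  -- A positive second derivative would make `a` a local minimum too, so k would be locally
  -- constant.
  have hmin := isLocalMin_of_deriv_deriv_pos (hdd ▸ hpos) h.deriv_eq_zero hk.self_of_nhds.continuousAt
  have hconst : k =ᶠ[𝓝 a] fun _ => k a := by
    filter_upwards [h, hmin] with s h1 h2 using le_antisymm h1 h2
  have h0 : deriv (deriv k) a = 0 := by
    have : deriv k =ᶠ[𝓝 a] fun _ => 0 := by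
      simpa using hconst.deriv
    rw [this.deriv_eq, deriv_const]
  linarith

set_option maxSynthPendingDepth 3 in
/-- Stability of nondegenerate tangential maxima: if `G` is `C²` at `x₀` and has a nondegenerate
maximum along `x₀ + range L`, then along the nearby translates `a + range L` it attains its
local maximum at every critical point, in a neighbourhood of uniform size. -/
lemma exists_forall_le_of_nondegenerate_max {X W : Type*} [NormedAddCommGroup X] [NormedSpace ℝ X]
    [NormedAddCommGroup W] [NormedSpace ℝ W] {G : X → ℝ} {x₀ : X} (hG : ContDiffAt ℝ 2 G x₀)
    (L : W →L[ℝ] X) {c : ℝ} (hc : 0 < c)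
    (h : ∀ᶠ τ in 𝓝 (0 : W), G (x₀ + L τ) ≤ G x₀ - c * ‖τ‖ ^ 2) :
    ∃ r > 0, ∀ a ∈ ball x₀ r, (∀ e, fderiv ℝ G a (L e) = 0) →
      ∀ τ : W, ‖τ‖ ≤ r → G (a + L τ) ≤ G a := by
  set H := fderiv ℝ (fderiv ℝ G) with hH
  have hline : ∀ (a v : X) (s : ℝ), ContDiffAt ℝ 2 G (a + s • v) →
      HasDerivAt (fun s : ℝ => G (a + s • v)) (fderiv ℝ G (a + s • v) v) s ∧
      HasDerivAt (fun s : ℝ => fderiv ℝ G (a + s • v) v) (H (a + s • v) v v) s := by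
    intro a v s hs
    have hl : HasDerivAt (fun s : ℝ => a + s • v) v s := by
      simpa using ((hasDerivAt_id s).smul_const v).const_add a
    have h1 := (hs.differentiableAt two_ne_zero).hasFDerivAt
    have h2 := ((hs.fderiv_right (m := 1) (by norm_num)).differentiableAt one_ne_zero).hasFDerivAt
    refine ⟨h1.comp_hasDerivAt s hl, ?_⟩
    have h3 := h2.comp_hasDerivAt s hl
    simpa using h3.clm_apply (hasDerivAt_const s v)
  have hev : ∀ᶠ x in 𝓝 x₀, ContDiffAt ℝ 2 G x := hG.eventually (by simp)
  have hneg : ∀ e, H x₀ (L e) (L e) ≤ -(2 * c * ‖e‖ ^ 2) := by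
    intro e
    have hl : Tendsto (fun s : ℝ => x₀ + s • L e) (𝓝 0) (𝓝 x₀) := by
      have : Continuous (fun s : ℝ => x₀ + s • L e) := by fun_prop
      simpa using this.tendsto 0
    have hl' : Tendsto (fun s : ℝ => s • e) (𝓝 0) (𝓝 0) := by
      have : Continuous (fun s : ℝ => s • e) := by fun_prop
      simpa using this.tendsto 0
    have hq : ∀ s : ℝ, HasDerivAt (fun s : ℝ => c * ‖e‖ ^ 2 * s ^ 2) (c * ‖e‖ ^ 2 * (2 * s)) s :=
      fun s => by simpa using (hasDerivAt_pow 2 s).const_mul (c * ‖e‖ ^ 2)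
    have hq' : HasDerivAt (fun s : ℝ => c * ‖e‖ ^ 2 * (2 * s)) (c * ‖e‖ ^ 2 * 2) 0 := by
      simpa using ((hasDerivAt_id (0 : ℝ)).const_mul 2).const_mul (c * ‖e‖ ^ 2)
    have := IsLocalMax.second_deriv_nonpos (a := 0)
      (k := fun s : ℝ => G (x₀ + s • L e) + c * ‖e‖ ^ 2 * s ^ 2)
      (k' := fun s : ℝ => fderiv ℝ G (x₀ + s • L e) (L e) + c * ‖e‖ ^ 2 * (2 * s))
      (k'' := H x₀ (L e) (L e) + c * ‖e‖ ^ 2 * 2) ?_ ?_ ?_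
    · linarith
    · filter_upwards [hl' h] with s hs
      have hs' : G (x₀ + L (s • e)) ≤ G x₀ - c * ‖s • e‖ ^ 2 := hs
      rw [map_smul, norm_smul, mul_pow, Real.norm_eq_abs, sq_abs] at hs'
      simp only [zero_smul, add_zero]
      linarith
    · filter_upwards [hl hev] with s hs using (hline x₀ (L e) s hs).1.add (hq s)
    · have := (hline x₀ (L e) 0 (by simpa using hG)).2
      rw [zero_smul, add_zero] at this
      exact this.add hq'
  have hHc : ContinuousAt H x₀ :=
    ((hG.fderiv_right (m := 1) (by norm_num)).fderiv_right (m := 0) (by norm_num)).continuousAt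
  -- With this tolerance the Hessian on Lτ changes by at most c‖τ‖², half of the margin 2c‖τ‖² in
  -- `hneg`.
  have hclose : ∀ᶠ x in 𝓝 x₀, ‖H x - H x₀‖ < c / (1 + ‖L‖ ^ 2) := by
    have h1 : Tendsto (fun x => ‖H x - H x₀‖) (𝓝 x₀) (𝓝 ‖H x₀ - H x₀‖) :=
      (hHc.sub continuousAt_const).norm
    rw [sub_self, norm_zero] at h1
    exact h1 (gt_mem_nhds (by positivity))
  obtain ⟨R, hR, hball⟩ := eventually_nhds_iff_ball.1 (hev.and hclose)
  have hr : 0 < R / (2 * (1 + ‖L‖)) := by positivity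
  refine ⟨R / (2 * (1 + ‖L‖)), hr, fun a ha hcrit τ hτ => ?_⟩
  have hmem : ∀ s ∈ Icc (0 : ℝ) 1, a + s • L τ ∈ ball x₀ R := by
    intro s hs
    rw [mem_ball, dist_eq_norm] at ha ⊢
    have h1 : ‖s • L τ‖ ≤ ‖L‖ * (R / (2 * (1 + ‖L‖))) := by
      rw [norm_smul, Real.norm_eq_abs, abs_of_nonneg hs.1]
      calc s * ‖L τ‖ ≤ 1 * ‖L τ‖ := by gcongr; exact hs.2
        _ ≤ ‖L‖ * ‖τ‖ := by rw [one_mul]; exact L.le_opNorm τ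
        _ ≤ _ := by gcongr
    have h2 : (1 + ‖L‖) * (R / (2 * (1 + ‖L‖))) = R / 2 := by field_simp
    calc ‖a + s • L τ - x₀‖ = ‖(a - x₀) + s • L τ‖ := by congr 1; abel
      _ ≤ ‖a - x₀‖ + ‖s • L τ‖ := norm_add_le _ _
      _ < R := by linarith
  have hH2 : ∀ s ∈ Icc (0 : ℝ) 1, H (a + s • L τ) (L τ) (L τ) ≤ 0 := by
    intro s hs
    have h1 := (hball _ (hmem s hs)).2
    rw [lt_div_iff₀ (by positivity)] at h1
    have h2 := ((H (a + s • L τ) - H x₀).le_opNorm₂ (L τ) (L τ))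
    have h3 : ‖H (a + s • L τ) - H x₀‖ * ‖L τ‖ * ‖L τ‖ ≤ c * ‖τ‖ ^ 2 := by
      calc _ ≤ ‖H (a + s • L τ) - H x₀‖ * (‖L‖ * ‖τ‖) * (‖L‖ * ‖τ‖) := by
            gcongr <;> exact L.le_opNorm τ
        _ = ‖H (a + s • L τ) - H x₀‖ * ‖L‖ ^ 2 * ‖τ‖ ^ 2 := by ring
        _ ≤ c * ‖τ‖ ^ 2 := by
            gcongr
            nlinarith [norm_nonneg (H (a + s • L τ) - H x₀)]
    have h4 := (le_abs_self _).trans (h2.trans h3)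
    simp only [sub_apply] at h4
    have h5 := hneg τ
    have h6 : 0 ≤ c * ‖τ‖ ^ 2 := by positivity
    linarith
  have hd := fun s hs => hline a (L τ) s (hball _ (hmem s hs)).1
  -- The slope along the segment is antitone and vanishes at s = 0, hence is nonpositive.
  have hanti : AntitoneOn (fun s : ℝ => fderiv ℝ G (a + s • L τ) (L τ)) (Icc 0 1) :=
    antitoneOn_of_deriv_nonpos (convex_Icc 0 1)
      (fun s hs => (hd s hs).2.continuousAt.continuousWithinAt)
      (fun s hs => (hd s (interior_subset hs)).2.differentiableAt.differentiableWithinAt)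
      (fun s hs => by
        rw [(hd s (interior_subset hs)).2.deriv]; exact hH2 s (interior_subset hs))
  have hanti' : AntitoneOn (fun s : ℝ => G (a + s • L τ)) (Icc 0 1) :=
    antitoneOn_of_deriv_nonpos (convex_Icc 0 1)
      (fun s hs => (hd s hs).1.continuousAt.continuousWithinAt)
      (fun s hs => (hd s (interior_subset hs)).1.differentiableAt.differentiableWithinAt)
      (fun s hs => by
        rw [(hd s (interior_subset hs)).1.deriv]
        have h01 : (0 : ℝ) ∈ Icc (0 : ℝ) 1 := by simp
        simpa [hcrit] using hanti h01 (interior_subset hs) (interior_subset hs).1)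
  simpa using hanti' (by simp : (0 : ℝ) ∈ Icc (0 : ℝ) 1) (by simp : (1 : ℝ) ∈ Icc (0 : ℝ) 1)
    zero_le_one

/-- A function that is `C¹` at `p` increases at a definite rate along any direction in which its
differential at `p` is positive. -/
lemma exists_add_mul_le_translate {E : Type*} [NormedAddCommGroup E] [NormedSpace ℝ E]
    {ρ : E → ℝ} {p N : E} (hρ : ContDiffAt ℝ 1 ρ p) (hN : 0 < fderiv ℝ ρ p N) :
    ∃ R > 0, ∃ m > 0, ∀ x s, 0 ≤ s → x ∈ ball p R → x + s • N ∈ ball p R →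
      ρ x + m * s ≤ ρ (x + s • N) := by
  have h1 : ∀ᶠ x in 𝓝 p, fderiv ℝ ρ p N / 2 < fderiv ℝ ρ x N := by
    have : ContinuousAt (fun x => fderiv ℝ ρ x N) p :=
      (hρ.fderiv_right (m := 0) (by norm_num)).continuousAt.clm_apply continuousAt_const
    exact this (lt_mem_nhds (by linarith))
  obtain ⟨R, hR, hball⟩ := eventually_nhds_iff_ball.1 (h1.and (hρ.eventually (by simp)))
  refine ⟨R, hR, fderiv ℝ ρ p N / 2, by positivity, fun x s hs hx hxs => ?_⟩
  have hmem : ∀ t ∈ Icc 0 s, x + t • N ∈ ball p R := by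
    intro t ht
    rcases hs.eq_or_lt with rfl | hs'
    · obtain rfl : t = 0 := le_antisymm ht.2 ht.1
      exact hxs
    · have h := (convex_ball p R).add_smul_mem hx hxs
        (t := t / s) ⟨by have := ht.1; positivity, (div_le_one hs').2 ht.2⟩
      rwa [smul_smul, div_mul_cancel₀ _ hs'.ne'] at h
  have hd : ∀ t ∈ Icc 0 s,
      HasDerivAt (fun t : ℝ => ρ (x + t • N)) (fderiv ℝ ρ (x + t • N) N) t := fun t ht => by
    have hl : HasDerivAt (fun t : ℝ => x + t • N) N t := by
      simpa using ((hasDerivAt_id t).smul_const N).const_add x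
    exact ((hball _ (hmem t ht)).2.differentiableAt one_ne_zero).hasFDerivAt.comp_hasDerivAt t hl
  have := (convex_Icc 0 s).mul_sub_le_image_sub_of_le_deriv (f := fun t : ℝ => ρ (x + t • N))
    (C := fderiv ℝ ρ p N / 2) (fun t ht => (hd t ht).continuousAt.continuousWithinAt)
    (fun t ht => (hd t (interior_subset ht)).differentiableAt.differentiableWithinAt)
    (fun t ht => by
      rw [(hd t (interior_subset ht)).deriv]
      exact (hball _ (hmem t (interior_subset ht))).1.le)
    0 ⟨le_rfl, hs⟩ s ⟨hs, le_rfl⟩ hs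
  simp only [sub_zero, zero_smul, add_zero] at this
  linarith

/-- A holomorphic disc along which `ρ` decays quadratically from a point where `ρ` is
differentiable is immersed at the centre. -/
lemma deriv_ne_zero_of_le_neg_sq {E : Type*} [NormedAddCommGroup E] [NormedSpace ℂ E]
    [CompleteSpace E] {ρ : E → ℝ} {ψ : ℂ → E} (hψ : Differentiable ℂ ψ)
    (hρ : DifferentiableAt ℝ ρ (ψ 0)) {c : ℝ} (hc : 0 < c)
    (h : ∀ᶠ σ in 𝓝 (0 : ℂ), ρ (ψ σ) ≤ ρ (ψ 0) - c * ‖σ‖ ^ 2) : deriv ψ 0 ≠ 0 := by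
  intro h0
  obtain ⟨χ, hχ, hψχ⟩ : ∃ χ : ℂ → E, Continuous χ ∧ ∀ σ, ψ σ = ψ 0 + σ ^ 2 • χ σ := by
    have hds : ∀ {f : ℂ → E}, Differentiable ℂ f → Differentiable ℂ (dslope f 0) := fun hf =>
      differentiableOn_univ.1 ((Complex.differentiableOn_dslope univ_mem).2 hf.differentiableOn)
    refine ⟨dslope (dslope ψ 0) 0, (hds (hds hψ)).continuous, fun σ => ?_⟩
    have h1 := sub_smul_dslope ψ 0 σ
    have h2 := sub_smul_dslope (dslope ψ 0) 0 σ
    rw [dslope_same, h0, sub_zero, sub_zero] at h2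
    rw [sub_zero] at h1
    rw [pow_two, mul_smul, h2, h1]
    abel
  set D := fderiv ℝ ρ (ψ 0) with hD
  have hψc : Tendsto ψ (𝓝 0) (𝓝 (ψ 0)) := hψ.continuous.tendsto 0
  have ho : (fun σ => ρ (ψ σ) - ρ (ψ 0) - D (σ ^ 2 • χ 0)) =o[𝓝 0] fun σ : ℂ => σ ^ 2 := by
    have h1 : (fun σ => ρ (ψ σ) - ρ (ψ 0) - D (ψ σ - ψ 0)) =o[𝓝 0] fun σ => ψ σ - ψ 0 :=
      hρ.hasFDerivAt.isLittleO.comp_tendsto hψc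
    have h2 : (fun σ => ψ σ - ψ 0) =O[𝓝 0] fun σ : ℂ => σ ^ 2 := by
      have : (fun σ => ψ σ - ψ 0) = fun σ => σ ^ 2 • χ σ := by
        ext1 σ; rw [hψχ σ, add_sub_cancel_left]
      rw [this]
      simpa using (Asymptotics.isBigO_refl (fun σ : ℂ => σ ^ 2) (𝓝 0)).smul
        ((hχ.tendsto 0).isBigO_one ℂ)
    have h3 : (fun σ : ℂ => D (σ ^ 2 • (χ σ - χ 0))) =o[𝓝 0] fun σ : ℂ => σ ^ 2 := by
      refine (D.isBigO_comp _ _).trans_isLittleO ?_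
      have : (fun σ => χ σ - χ 0) =o[𝓝 0] fun _ : ℂ => (1 : ℂ) := by
        rw [Asymptotics.isLittleO_one_iff]
        simpa using (hχ.tendsto 0).sub_const (χ 0)
      simpa using (Asymptotics.isBigO_refl (fun σ : ℂ => σ ^ 2) (𝓝 0)).smul_isLittleO this
    refine ((h1.trans_isBigO h2).add h3).congr_left fun σ => ?_
    rw [hψχ σ, add_sub_cancel_left, smul_sub, map_sub]
    ring
  have hev : ∀ᶠ σ in 𝓝 (0 : ℂ), -(c / 2 * ‖σ‖ ^ 2) ≤ -(c * ‖σ‖ ^ 2) - D (σ ^ 2 • χ 0) := by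
    filter_upwards [h, ho.bound (show 0 < c / 2 by positivity)] with σ h1 h2
    rw [Real.norm_eq_abs, norm_pow] at h2
    linarith [(abs_le.1 h2).1]
  -- Replacing σ by iσ changes the sign of the leading term D(σ²χ(0)), which therefore cannot be
  -- negative for both.
  have hI : Tendsto (fun σ : ℂ => Complex.I * σ) (𝓝 0) (𝓝 0) := by
    have : Continuous (fun σ : ℂ => Complex.I * σ) := by fun_prop
    simpa using this.tendsto 0
  obtain ⟨σ, ⟨h1, h2⟩, hσ⟩ := (((hev.and (hI.eventually hev)).filter_mono
    (nhdsWithin_le_nhds (s := {0}ᶜ))).and self_mem_nhdsWithin).exists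
  rw [norm_mul, Complex.norm_I, one_mul, mul_pow, Complex.I_sq, neg_one_mul, neg_smul,
    map_neg] at h2
  have : 0 < c * ‖σ‖ ^ 2 := by have : σ ≠ 0 := hσ; positivity
  linarith

/-! ### Sliding curves contradict visibility -/

/-- A curve in the complement of `Ω` whose small translates in the direction `-N` lie in `Ω` and
have uniformly bounded Kobayashi-Royden speed. -/
structure IsSlidingCurve {n : ℕ} (Ω : Set (Cn n)) (γ : ℝ → Cn n) (N : Cn n) (a r b B t₀ : ℝ) :
    Prop where
  notMem : ∀ s ∈ Icc 0 a, γ s ∉ Ω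
  le_dist : ∀ s ∈ Icc 0 a, ∀ s' ∈ Icc 0 a, b * |s - s'| ≤ dist (γ s) (γ s')
  dist_le : ∀ s ∈ Icc 0 a, ∀ s' ∈ Icc 0 a, dist (γ s) (γ s') ≤ B * |s - s'|
  translate_mem : ∀ s ∈ Icc 0 a, ∀ t ∈ Ioo 0 t₀, γ s - t • N ∈ Ω
  speed_le : ∀ s ∈ Icc 0 a, ∀ t ∈ Ioo 0 t₀,
    kobayashiRoyden Ω (γ s - t • N) (deriv γ s) ≤ ENNReal.ofReal r⁻¹

/-- The translates of a sliding curve approach the boundary and are almost geodesics, for every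
choice of constants compatible with the bounds for speed and distance, so that visibility fails. -/
lemma IsSlidingCurve.not_hasVisibility {n : ℕ} {Ω : Set (Cn n)} {γ : ℝ → Cn n} {N : Cn n}
    {a a' r b B t₀ m lam ε : ℝ} (hopen : IsOpen Ω) (hγ : IsSlidingCurve Ω γ N a' r b B t₀)
    (ha : 0 < a) (haa' : a ≤ a') (hr : 0 < r) (hb : 0 < b) (ht₀ : 0 < t₀)
    (hlam : 0 ≤ lam) (hε : 0 ≤ ε)
    (hm : 0 < m) (hk : ∀ x y : Cn n, ENNReal.ofReal (m * dist x y) ≤ kobayashiDist Ω x y)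
    (hlen : ∀ d ∈ Icc 0 a, r⁻¹ * d ≤ lam * (m * (b * d)) + ε) : ¬ HasVisibility Ω lam ε := by
  intro hvis
  have hsub : Icc 0 a ⊆ Icc 0 a' := Icc_subset_Icc_right haa'
  have h0 : (0 : ℝ) ∈ Icc 0 a := ⟨le_rfl, ha.le⟩
  have h1 : a ∈ Icc 0 a := ⟨ha.le, le_rfl⟩
  have hlim : ∀ s, Tendsto (fun t : ℝ => γ s - t • N) (𝓝[>] 0) (𝓝 (γ s)) := fun s => by
    have : Continuous (fun t : ℝ => γ s - t • N) := by fun_prop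
    simpa using (this.tendsto 0).mono_left nhdsWithin_le_nhds
  have hIoo : ∀ᶠ t in 𝓝[>] (0 : ℝ), t ∈ Ioo 0 t₀ := Ioo_mem_nhdsGT ht₀
  have hfr : ∀ s ∈ Icc 0 a, γ s ∈ frontier Ω := fun s hs => by
    rw [hopen.frontier_eq]
    exact ⟨mem_closure_of_tendsto (hlim s) (hIoo.mono fun t ht =>
      hγ.translate_mem s (hsub hs) t ht), hγ.notMem s (hsub hs)⟩
  have hne : γ 0 ≠ γ a := by
    rw [← dist_pos]
    refine lt_of_lt_of_le ?_ (hγ.le_dist 0 (hsub h0) a (hsub h1))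
    have : 0 < |0 - a| := by simpa using ha.ne'
    positivity
  obtain ⟨U, hU, V, hV, K, hK, hKΩ, hmeet⟩ := hvis _ (hfr 0 h0) _ (hfr a h1) hne
  obtain ⟨δ, hδ, hthick⟩ := hK.exists_thickening_subset_open hopen hKΩ
  have hsmall : ∀ᶠ t in 𝓝[>] (0 : ℝ), ‖t • N‖ < δ := by
    have : Continuous (fun t : ℝ => ‖t • N‖) := by fun_prop
    have := (this.tendsto 0).mono_left (nhdsWithin_le_nhds (s := Ioi 0))
    rw [zero_smul, norm_zero] at this
    exact this (gt_mem_nhds hδ)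
  obtain ⟨t, ⟨⟨ht, htδ⟩, htU⟩, htV⟩ := (((hIoo.and hsmall).and (hlim 0 hU)).and (hlim a hV)).exists
  have hderiv : ∀ s, deriv (fun s => γ s - t • N) s = deriv γ s := fun s => deriv_sub_const _
  have hgeo : IsAlmostGeodesic Ω lam ε a (fun s => γ s - t • N) := by
    refine ⟨ha.le, fun s hs => hγ.translate_mem s (hsub hs) t ht, ?_, ?_⟩
    · refine LipschitzOnWith.absolutelyContinuousOnInterval (K := B.toNNReal) ?_
      rw [uIcc_of_le ha.le]
      refine LipschitzOnWith.of_dist_le_mul fun x hx y hy => ?_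
      rw [dist_sub_right, Real.dist_eq]
      refine (hγ.dist_le x (hsub hx) y (hsub hy)).trans ?_
      gcongr
      exact Real.le_coe_toNNReal B
    · intro s₁ s₂ h1 h12 h2
      have hd : 0 ≤ s₂ - s₁ := sub_nonneg.2 h12
      calc kobayashiLength Ω (fun s => γ s - t • N) s₁ s₂
          ≤ ∫⁻ _ in Icc s₁ s₂, ENNReal.ofReal r⁻¹ := by
            refine setLIntegral_mono measurable_const fun s hs => ?_
            rw [hderiv]
            exact hγ.speed_le s (hsub ⟨h1.trans hs.1, hs.2.trans h2⟩) t ht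
        _ = ENNReal.ofReal (r⁻¹ * (s₂ - s₁)) := by
            rw [setLIntegral_const, Real.volume_Icc, ENNReal.ofReal_mul (by positivity)]
        _ ≤ ENNReal.ofReal (lam * (m * dist (γ s₁ - t • N) (γ s₂ - t • N)) + ε) := by
            refine ENNReal.ofReal_le_ofReal ((hlen _ ⟨hd, by linarith⟩).trans ?_)
            gcongr
            rw [dist_sub_right, dist_comm]
            simpa [abs_of_nonneg hd] using
              hγ.le_dist s₂ (hsub ⟨h1.trans h12, h2⟩) s₁ (hsub ⟨h1, h12.trans h2⟩)
        _ ≤ _ := by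
            rw [ENNReal.ofReal_add (by positivity) hε, ENNReal.ofReal_mul hlam]
            gcongr
            exact hk _ _
  obtain ⟨x, ⟨s, hs, rfl⟩, hxK⟩ := hmeet a _ hgeo
    ⟨hγ.translate_mem 0 (hsub h0) t ht, htU⟩ ⟨hγ.translate_mem a (hsub h1) t ht, htV⟩
  -- A translate meeting K would put γ(s) within δ of K, hence in Ω.
  refine hγ.notMem s (hsub hs) (hthick (mem_thickening_iff.2 ⟨_, hxK, ?_⟩))
  simpa [dist_eq_norm] using htδ

/-! ### Construction of a sliding curve -/

/-- A local defining function is nonpositive where a holomorphic disc penetrates `Ω`, with a bound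
in terms of the distance to the complement. -/
lemma eventually_le_neg_sq_of_le_infDist {n : ℕ} {Ω U : Set (Cn n)} {ρ : Cn n → ℝ} {N : Cn n}
    {ψ : ℂ → Cn n} (hU : U ∈ 𝓝 (ψ 0)) (hρ : ContDiffAt ℝ 1 ρ (ψ 0)) (hρ0 : ρ (ψ 0) = 0)
    (hN : 0 < fderiv ℝ ρ (ψ 0) N) (hΩU : ∀ x ∈ U, x ∈ Ω ↔ ρ x < 0) (hψ : Continuous ψ) {c : ℝ}
    (hc : 0 < c) (h : ∀ᶠ σ in 𝓝 (0 : ℂ), c * ‖σ‖ ^ 2 ≤ infDist (ψ σ) Ωᶜ) :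
    ∃ c' > 0, ∀ᶠ σ in 𝓝 (0 : ℂ), ρ (ψ σ) ≤ ρ (ψ 0) - c' * ‖σ‖ ^ 2 := by
  obtain ⟨R, hR, m, hm, htrans⟩ := exists_add_mul_le_translate hρ hN
  -- Moving ψ(σ) by k|σ|²N costs at most half of its distance to the complement, so ρ is still
  -- negative there; growth of ρ along N then gives the decay at ψ(σ).
  set k := c / (2 * (1 + ‖N‖)) with hk
  have hk0 : 0 < k := by positivity
  have hkN : k * ‖N‖ ≤ c / 2 := by
    rw [hk, div_mul_eq_mul_div, div_le_div_iff₀ (by positivity) (by positivity)]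
    nlinarith
  refine ⟨m * k, by positivity, ?_⟩
  have hlim : Tendsto ψ (𝓝 0) (𝓝 (ψ 0)) := hψ.tendsto 0
  have hlim' : Tendsto (fun σ => ψ σ + (k * ‖σ‖ ^ 2) • N) (𝓝 0) (𝓝 (ψ 0)) := by
    have : Continuous (fun σ => ψ σ + (k * ‖σ‖ ^ 2) • N) := by fun_prop
    simpa using this.tendsto 0
  filter_upwards [h, hlim (ball_mem_nhds _ hR), hlim' (ball_mem_nhds _ hR), hlim' hU]
    with σ h1 h2 h3 h4
  by_cases hmem : ψ σ + (k * ‖σ‖ ^ 2) • N ∈ Ω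
  · have h5 := htrans _ (k * ‖σ‖ ^ 2) (by positivity) h2 h3
    have h6 := (hΩU _ h4).1 hmem
    rw [hρ0]
    linarith
  · have h5 : infDist (ψ σ) Ωᶜ ≤ c / 2 * ‖σ‖ ^ 2 := by
      refine (infDist_le_dist_of_mem hmem).trans ?_
      rw [dist_self_add_right, norm_smul, Real.norm_of_nonneg (by positivity)]
      nlinarith [sq_nonneg ‖σ‖]
    have h6 : ‖σ‖ ^ 2 = 0 := by nlinarith [sq_nonneg ‖σ‖]
    have h7 : σ = 0 := by simpa using h6
    simp [h7]

/-- At a boundary point where a holomorphic disc touches the boundary from inside to second order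
there starts a sliding curve. -/
lemma exists_isSlidingCurve {n : ℕ} {Ω : Set (Cn n)} (hopen : IsOpen Ω) (hC2 : HasC2Boundary Ω)
    {ψ : ℂ → Cn n} (hψ : Differentiable ℂ ψ) (hp : ψ 0 ∈ frontier Ω) {c : ℝ} (hc : 0 < c)
    (h : ∀ᶠ σ in 𝓝 (0 : ℂ), c * ‖σ‖ ^ 2 ≤ infDist (ψ σ) Ωᶜ) :
    ∃ (γ : ℝ → Cn n) (N : Cn n) (a r b B t₀ : ℝ), 0 < a ∧ 0 < r ∧ 0 < b ∧ 0 < t₀ ∧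
      IsSlidingCurve Ω γ N a r b B t₀ := by
  obtain ⟨U, ρ, hUo, hpU, hρU, hdρ, hΩ⟩ := hC2 _ hp
  set p := ψ 0 with hpdef
  have hU : U ∈ 𝓝 p := hUo.mem_nhds hpU
  have hΩU : ∀ x ∈ U, x ∈ Ω ↔ ρ x < 0 := fun x hx => by
    have := congrArg (x ∈ ·) hΩ
    simpa [hx] using this
  have hρ2 : ContDiffAt ℝ 2 ρ p := hρU.contDiffAt hU
  have hρ1 : ContDiffAt ℝ 1 ρ p := hρ2.of_le (by norm_num)
  have hρp : ρ p = 0 := by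
    rw [hopen.frontier_eq] at hp
    refine le_antisymm ?_ (not_lt.1 fun hlt => hp.2 ((hΩU p hpU).2 hlt))
    refine le_of_tendsto_of_frequently hρ2.continuousAt ?_
    exact ((mem_closure_iff_frequently.1 hp.1).and_eventually hU).mono fun x hx =>
      ((hΩU x hx.2).1 hx.1).le
  obtain ⟨N, hN⟩ : ∃ N, 0 < fderiv ℝ ρ p N := by
    obtain ⟨v, hv⟩ := DFunLike.ne_iff.1 (hdρ p hpU)
    rcases lt_or_gt_of_ne hv with hv | hv
    · exact ⟨-v, by simpa using hv⟩
    · exact ⟨v, hv⟩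
  obtain ⟨c', hc', hdecay⟩ := eventually_le_neg_sq_of_le_infDist hU hρ1 hρp hN hΩU
    hψ.continuous hc h
  set w₀ := deriv ψ 0 with hw₀
  have hw₀ne : w₀ ≠ 0 :=
    deriv_ne_zero_of_le_neg_sq hψ (hρ1.differentiableAt one_ne_zero) hc' hdecay
  have hψ' : HasFDerivAt ψ ((ContinuousLinearMap.toSpanSingleton ℂ w₀).restrictScalars ℝ) 0 := by
    exact (hψ 0).hasDerivAt.hasFDerivAt.restrictScalars ℝ
  have htan : ∀ ζ : ℂ, fderiv ℝ ρ p (ζ • w₀) = 0 := by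
    have hmax : IsLocalMax (fun σ => ρ (ψ σ)) 0 := by
      filter_upwards [hdecay] with σ hσ
      have : 0 ≤ c' * ‖σ‖ ^ 2 := by positivity
      linarith
    have := hmax.hasFDerivAt_eq_zero
      ((hρ1.differentiableAt one_ne_zero).hasFDerivAt.comp (0 : ℂ) hψ')
    intro ζ
    simpa using congrArg (fun L => L ζ) this
  -- The complex-linear form with real part dρ; its kernel is the complex tangent space of the level
  -- set of ρ.
  let θ : Cn n → StrongDual ℂ (Cn n) := fun x =>
    StrongDual.extendRCLike (fderiv ℝ ρ x)
  have hθ : ∀ x y, θ x y = (fderiv ℝ ρ x y : ℂ) - Complex.I * (fderiv ℝ ρ x (Complex.I • y) : ℂ) :=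
    fun x y => by simp [θ, StrongDual.extendRCLike_apply]
  have hθre : ∀ x y, (θ x y).re = fderiv ℝ ρ x y := fun x y => by simp [hθ]
  have hθC1 : ∀ y, ContDiffAt ℝ 1 (fun x => θ x y) p := fun y => by
    have hD : ContDiffAt ℝ 1 (fderiv ℝ ρ) p := hρ2.fderiv_right (by norm_num)
    have hof : ∀ v, ContDiffAt ℝ 1 (fun x => (fderiv ℝ ρ x v : ℂ)) p := fun v =>
      Complex.ofRealCLM.contDiff.contDiffAt.comp p (hD.clm_apply contDiffAt_const)
    simp only [hθ]
    exact (hof y).sub (contDiffAt_const.mul (hof _))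
  have hθN : θ p N ≠ 0 := fun h0 => by
    have := hθre p N
    rw [h0, Complex.zero_re] at this
    exact hN.ne this
  have hθw₀ : θ p w₀ = 0 := by
    rw [hθ, htan, ← one_smul ℂ w₀, htan]; simp
  -- Projection of w₀ along N to ker θ. It is C¹ because ρ is C², which is what the integral curve
  -- needs.
  let w : Cn n → Cn n := fun x => w₀ - (θ x w₀ / θ x N) • N
  have hwp : w p = w₀ := by simp [w, hθw₀]
  have hθw : ∀ x, θ x N ≠ 0 → θ x (w x) = 0 := fun x hx => by
    simp [w, hx]
  have hwC1 : ContDiffAt ℝ 1 w p := by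
    have h1 : ContDiffAt ℝ 1 (fun x => θ x w₀ / θ x N) p := by
      simp only [div_eq_mul_inv]
      exact (hθC1 w₀).mul ((hθC1 N).inv hθN)
    exact contDiffAt_const.sub (h1.smul (contDiffAt_const (c := N)))
  obtain ⟨γ, hγ0, η, hη, hγ⟩ :=
    hwC1.exists_forall_mem_closedBall_exists_eq_forall_mem_Ioo_hasDerivAt₀ 0
  -- the family of discs, parametrised by their base point and direction
  let Φ : Cn n × Cn n × ℂ → Cn n := fun x => ψ x.2.2 + x.1 + x.2.2 • x.2.1
  have hψR : ContDiff ℝ 2 ψ := (hψ.contDiff (n := 2)).restrict_scalars ℝ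
  have hΦ : ContDiff ℝ 2 Φ := by
    refine ((hψR.comp (contDiff_snd.comp contDiff_snd)).add contDiff_fst).add ?_
    exact (contDiff_snd.comp contDiff_snd).smul (contDiff_fst.comp contDiff_snd)
  have hΦ0 : Φ 0 = p := by simp [Φ, hpdef]
  have hGC2 : ContDiffAt ℝ 2 (ρ ∘ Φ) 0 := by
    refine ContDiffAt.comp 0 ?_ hΦ.contDiffAt
    rw [hΦ0]; exact hρ2
  let L : ℂ →L[ℝ] Cn n × Cn n × ℂ :=
    (ContinuousLinearMap.inr ℝ (Cn n) (Cn n × ℂ)).comp (ContinuousLinearMap.inr ℝ (Cn n) ℂ)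
  have hL : ∀ τ, L τ = (0, 0, τ) := fun τ => by simp [L]
  -- `L` includes the disc variable, so `r₁` is uniform in the base point and the direction.
  obtain ⟨r₁, hr₁, hmaxG⟩ := exists_forall_le_of_nondegenerate_max hGC2 L hc' (by
    filter_upwards [hdecay] with σ hσ
    simpa [hL, Φ] using hσ)
  obtain ⟨R, hR, m, hm, htrans⟩ := exists_add_mul_le_translate hρ1 hN
  obtain ⟨R', hR', hball⟩ := eventually_nhds_iff_ball.1
    ((eventually_mem_nhds_iff.2 hU).and (ball_mem_nhds p hR))
  obtain ⟨r₂, hr₂, hΦball⟩ := Metric.continuousAt_iff.1 (hΦ.continuous.continuousAt (x := 0))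
    (R' / 2) (by positivity)
  rw [hΦ0] at hΦball
  set r := min r₁ r₂ / 2 with hr
  have hr0 : 0 < r := by positivity
  have hrr₁ : r < r₁ := by have := min_le_left r₁ r₂; have := lt_min hr₁ hr₂; linarith
  have hrr₂ : r < r₂ := by have := min_le_right r₁ r₂; have := lt_min hr₁ hr₂; linarith
  -- restriction to a short time interval
  have hγc : Tendsto γ (𝓝 0) (𝓝 p) := by
    have := (hγ 0 (by simp [hη])).continuousAt.tendsto
    rwa [hγ0] at this
  have hγw : Tendsto (fun s => w (γ s)) (𝓝 0) (𝓝 w₀) := by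
    have := hwC1.continuousAt.tendsto
    rw [hwp] at this
    exact this.comp hγc
  have hev : ∀ᶠ s in 𝓝 (0 : ℝ), s ∈ Ioo (0 - η) (0 + η) ∧ γ s ∈ U ∧ θ (γ s) N ≠ 0 ∧
      DifferentiableAt ℝ ρ (γ s) ∧ dist (γ s) p < r ∧ dist (w (γ s)) w₀ < min r (‖w₀‖ / 2) := by
    have hw2 : 0 < min r (‖w₀‖ / 2) := by positivity
    filter_upwards [Ioo_mem_nhds (show 0 - η < 0 by linarith) (show 0 < 0 + η by linarith),
      hγc hU, hγc.eventually ((hθC1 N).continuousAt.eventually_ne hθN),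
      hγc.eventually (hρ1.eventually (by simp)), hγc (ball_mem_nhds p hr0),
      hγw (ball_mem_nhds w₀ hw2)] with s h1 h2 h3 h4 h5 h6
    exact ⟨h1, h2, h3, h4.differentiableAt one_ne_zero, h5, h6⟩
  obtain ⟨a', ha', hs⟩ := eventually_nhds_iff_ball.1 hev
  replace hs : ∀ s ∈ Icc 0 (a' / 2), _ := fun s h => hs s (by
    rw [Real.ball_eq_Ioo]; constructor <;> linarith [h.1, h.2])
  have ha : 0 < a' / 2 := by positivity
  have hγd : ∀ s ∈ Icc 0 (a' / 2), HasDerivAt γ (w (γ s)) s := fun s h => hγ s (hs s h).1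
  have hρtan : ∀ s ∈ Icc 0 (a' / 2), ∀ ζ : ℂ, fderiv ℝ ρ (γ s) (ζ • w (γ s)) = 0 := by
    intro s h ζ
    rw [← hθre, map_smul, hθw (γ s) (hs s h).2.2.1, smul_zero, Complex.zero_re]
  have hργ : ∀ s ∈ Icc 0 (a' / 2), ρ (γ s) = 0 := by
    have hd : ∀ s ∈ Icc 0 (a' / 2), HasDerivAt (fun s => ρ (γ s)) 0 s := fun s h => by
      have h1 := (hs s h).2.2.2.1.hasFDerivAt.comp_hasDerivAt s (hγd s h)
      have h2 := hρtan s h 1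
      rw [one_smul] at h2
      rwa [h2] at h1
    intro s h
    rw [constant_of_has_deriv_right_zero (f := fun s => ρ (γ s))
      (fun s h => (hd s h).continuousAt.continuousWithinAt)
      (fun s h => (hd s (Ico_subset_Icc_self h)).hasDerivWithinAt) s h, hγ0, hρp]
  -- γ is close to a line with velocity w₀, which yields the bi-Lipschitz constants ‖w₀‖/2 and
  -- 3‖w₀‖/2.
  have hlip : ∀ s ∈ Icc 0 (a' / 2), ∀ s' ∈ Icc 0 (a' / 2),
      ‖(γ s - γ s') - (s - s') • w₀‖ ≤ ‖w₀‖ / 2 * |s - s'| := by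
    intro s h s' h'
    have := (convex_Icc 0 (a' / 2)).norm_image_sub_le_of_norm_hasDerivWithin_le
      (f := fun s => γ s - s • w₀) (f' := fun s => w (γ s) - w₀) (C := ‖w₀‖ / 2)
      (fun s h => ((hγd s h).sub (by
        simpa using (hasDerivAt_id s).smul_const w₀)).hasDerivWithinAt)
      (fun s h => by
        rw [← dist_eq_norm]; exact (lt_min_iff.1 (hs s h).2.2.2.2.2).2.le) h' h
    rw [Real.norm_eq_abs] at this
    convert! this using 2
    rw [sub_smul]; abel
  -- the discs centred on the curve
  have hdisc : ∀ s ∈ Icc 0 (a' / 2), ∀ t ∈ Ioo 0 (R' / (2 * (1 + ‖N‖))), ∀ τ : ℂ, ‖τ‖ ≤ r →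
      Φ (γ s - p, w (γ s) - w₀, τ) - t • N ∈ Ω := by
    intro s h t ht τ hτ
    obtain ⟨-, -, -, hρs, hγs, hws⟩ := hs s h
    have hws' := (lt_min_iff.1 hws).1
    rw [dist_eq_norm] at hγs hws'
    have hbase : Φ (γ s - p, w (γ s) - w₀, 0) = γ s := by simp [Φ, hpdef]
    have h1 : ρ (Φ (γ s - p, w (γ s) - w₀, τ)) ≤ 0 := by
      have := hmaxG (γ s - p, w (γ s) - w₀, 0) ?_ ?_ τ (hτ.trans hrr₁.le)
      · rw [hL] at this
        simpa [hbase, hργ s h] using this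
      · simp only [mem_ball, dist_zero_right, Prod.norm_def, norm_zero]
        exact max_lt (hγs.trans hrr₁) (max_lt (hws'.trans hrr₁) hr₁)
      -- Criticality holds because the disc has derivative w(γ(s)) at its centre, and dρ vanishes on
      -- its complex multiples.
      · intro e
        have hΦd : HasFDerivAt Φ (fderiv ℝ Φ (γ s - p, w (γ s) - w₀, 0))
          (γ s - p, w (γ s) - w₀, 0) := (hΦ.differentiable two_ne_zero _).hasFDerivAt
        have hρd : HasFDerivAt ρ (fderiv ℝ ρ (γ s)) (Φ (γ s - p, w (γ s) - w₀, 0)) := by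
          rw [hbase]; exact hρs.hasFDerivAt
        have hpar : HasFDerivAt (fun τ : ℂ => (γ s - p, w (γ s) - w₀, τ)) L 0 := by
          simpa [hL] using (L.hasFDerivAt (x := 0)).const_add (γ s - p, w (γ s) - w₀, (0 : ℂ))
        have hsl : HasFDerivAt (fun τ : ℂ => Φ (γ s - p, w (γ s) - w₀, τ))
            ((ContinuousLinearMap.toSpanSingleton ℂ (w (γ s))).restrictScalars ℝ) 0 := by
          have h2 : HasDerivAt (fun τ : ℂ => Φ (γ s - p, w (γ s) - w₀, τ)) (w (γ s)) 0 := by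
            have := ((hψ 0).hasDerivAt.add_const (γ s - p)).add
              ((hasDerivAt_id (0 : ℂ)).smul_const (w (γ s) - w₀))
            simpa [hw₀] using! this
          exact h2.hasFDerivAt.restrictScalars ℝ
        have hcomp : HasFDerivAt (fun τ : ℂ => Φ (γ s - p, w (γ s) - w₀, τ))
            ((fderiv ℝ Φ (γ s - p, w (γ s) - w₀, 0)).comp L) 0 :=
          HasFDerivAt.comp (g := Φ) (0 : ℂ) hΦd hpar
        have heq := hcomp.unique hsl
        rw [(hρd.comp _ hΦd).fderiv]
        have h3 : fderiv ℝ Φ (γ s - p, w (γ s) - w₀, 0) (L e) = e • w (γ s) := by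
          simpa using congrArg (fun T => T e) heq
        rw [ContinuousLinearMap.comp_apply, h3, hρtan s h]
    have h2 : dist (Φ (γ s - p, w (γ s) - w₀, τ)) p < R' / 2 := by
      apply hΦball
      simp only [dist_zero_right, Prod.norm_def]
      exact max_lt (hγs.trans hrr₂) (max_lt (hws'.trans hrr₂) (hτ.trans_lt hrr₂))
    have h3 : ‖t • N‖ ≤ R' / 2 := by
      rw [norm_smul, Real.norm_of_nonneg ht.1.le]
      have := (lt_div_iff₀ (by positivity)).1 ht.2
      nlinarith [norm_nonneg N, ht.1]
    have h4 : Φ (γ s - p, w (γ s) - w₀, τ) - t • N ∈ ball p R' := by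
      rw [mem_ball]
      calc _ ≤ dist (Φ (γ s - p, w (γ s) - w₀, τ) - t • N) (Φ (γ s - p, w (γ s) - w₀, τ)) +
            dist (Φ (γ s - p, w (γ s) - w₀, τ)) p := dist_triangle _ _ _
        _ < R' := by
          have : dist (Φ (γ s - p, w (γ s) - w₀, τ) - t • N) (Φ (γ s - p, w (γ s) - w₀, τ)) =
            ‖t • N‖ := by simp
          linarith
    have h5 := htrans _ t ht.1.le (hball _ h4).2 (by
      rw [sub_add_cancel]
      exact (hball _ (mem_ball.2 (h2.trans (by linarith)))).2)
    rw [sub_add_cancel] at h5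
    have : 0 < m * t := mul_pos hm ht.1
    exact (hΩU _ (mem_of_mem_nhds (hball _ h4).1)).2 (by linarith)
  refine ⟨γ, N, a' / 2, r, ‖w₀‖ / 2, 3 / 2 * ‖w₀‖, R' / (2 * (1 + ‖N‖)), ha, hr0, by positivity,
    by positivity, ?_, ?_, ?_, ?_, ?_⟩
  · intro s h hmem
    exact ((hΩU _ (hs s h).2.1).1 hmem).ne (hργ s h)
  · intro s h s' h'
    have h1 := hlip s h s' h'
    have h2 := norm_sub_norm_le ((s - s') • w₀) (γ s - γ s')
    rw [norm_sub_rev] at h1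
    rw [norm_smul, Real.norm_eq_abs] at h2
    rw [dist_eq_norm]
    linarith
  · intro s h s' h'
    have h1 := hlip s h s' h'
    have h2 := norm_sub_norm_le (γ s - γ s') ((s - s') • w₀)
    rw [norm_smul, Real.norm_eq_abs] at h2
    rw [dist_eq_norm]
    linarith
  · intro s h t ht
    simpa [Φ, hpdef] using hdisc s h t ht 0 (by simpa using hr0.le)
  · intro s h t ht
    rw [(hγd s h).deriv]
    have hφ : HasDerivAt (fun ζ : ℂ => Φ (γ s - p, w (γ s) - w₀, (r : ℂ) * ζ) - t • N)
        ((r : ℂ) • w (γ s)) 0 := by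
      have h1 : HasDerivAt (fun ζ : ℂ => (r : ℂ) * ζ) (r : ℂ) 0 := by
        simpa using (hasDerivAt_id (0 : ℂ)).const_mul (r : ℂ)
      have h2 : HasDerivAt ψ w₀ ((r : ℂ) * 0) := by
        rw [mul_zero]; exact (hψ 0).hasDerivAt
      have h3 := (((h2.scomp 0 h1).add_const (γ s - p)).add
        (h1.smul_const (w (γ s) - w₀))).sub_const (t • N)
      rw [← smul_add, add_sub_cancel] at h3
      exact h3
    -- Rescaling the disc of radius r to the unit disc gives derivative r·w(γ(s)), hence the
    -- competitor α = 1/r.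
    refine iInf_le_of_le (fun ζ : ℂ => Φ (γ s - p, w (γ s) - w₀, (r : ℂ) * ζ) - t • N)
      (iInf_le_of_le ((r : ℂ)⁻¹) (iInf_le_of_le ⟨⟨?_, ?_⟩, ?_, ?_⟩ ?_))
    · have : Differentiable ℂ fun ζ : ℂ => Φ (γ s - p, w (γ s) - w₀, (r : ℂ) * ζ) - t • N := by
        simp only [Φ]; fun_prop
      exact this.differentiableOn
    · intro ζ hζ
      refine hdisc s h t ht _ ?_
      rw [norm_mul, Complex.norm_real, Real.norm_of_nonneg hr0.le]
      have : ‖ζ‖ < 1 := by simpa using hζ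
      nlinarith
    · simp [Φ, hpdef]
    · rw [hφ.deriv, inv_smul_smul₀ (by exact_mod_cast hr0.ne')]
    · rw [← ofReal_norm, norm_inv, Complex.norm_real, Real.norm_of_nonneg hr0.le]

/-! ### Conclusion -/

theorem theorem1 {n : ℕ} (Ω : Set (Cn n)) (hopen : IsOpen Ω) (hconn : IsConnected Ω)
    (hbdd : Bornology.IsBounded Ω) (hC2 : HasC2Boundary Ω)
    (hvis : (∃ ε : ℝ, 0 < ε ∧ HasVisibility Ω 1 ε) ∨
      (∀ lam : ℝ, 1 < lam → HasVisibility Ω lam 0)) :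
    IsPseudoconvex Ω := by
  -- An empty complement, possible only for n = 0, is separate because `infDist` to ∅ is 0 by
  -- default.
  rcases Ωᶜ.eq_empty_or_nonempty with hempty | hne
  · rw [compl_empty_iff] at hempty
    subst hempty
    refine ⟨fun _ => 0, ⟨continuousOn_const, fun z w _ => by simp [Real.circleAverage_const]⟩,
      fun c => ?_⟩
    by_cases hc : 0 ≤ c
    · simpa [hc] using Metric.isCompact_of_isClosed_isBounded isClosed_univ hbdd
    · simp [hc]
  have hpos : ∀ x, x ∈ Ω ↔ 0 < infDist x Ωᶜ := fun x => by
    rw [← hopen.isClosed_compl.notMem_iff_infDist_pos hne, notMem_compl_iff]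
  refine ⟨fun z => -Real.log (infDist z Ωᶜ), ⟨?_, ?_⟩, fun c => ?_⟩
  · exact ((continuous_infDist_pt _).continuousOn.log fun x hx => ((hpos x).1 hx).ne').neg
  · intro z w hzw
    by_contra! hlt
    obtain ⟨ψ, hψ, hψ0, c, hc, htouch⟩ := exists_inner_touching_disc hopen hne hzw hlt
    obtain ⟨γ, N, a, r, b, B, t₀, ha, hr, hb, ht₀, hγ⟩ :=
      exists_isSlidingCurve hopen hC2 hψ hψ0 hc htouch
    obtain ⟨m, hm, hk⟩ := exists_mul_dist_le_kobayashiDist hbdd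
    rcases hvis with ⟨ε, hε, hvis⟩ | hvis
    -- Cutting the curve at rε makes its length at most ε, so the distance term is not needed.
    · refine hγ.not_hasVisibility (a := min a (r * ε)) hopen (by positivity) (min_le_left _ _) hr
        hb ht₀ zero_le_one hε.le hm hk (fun d hd => ?_) hvis
      have h1 : r⁻¹ * d ≤ ε := by
        rw [inv_mul_le_iff₀ hr]; exact hd.2.trans (min_le_right _ _)
      have h2 : 0 ≤ 1 * (m * (b * d)) := by have := hd.1; positivity
      linarith
    -- The first summand is the ratio of the speed bound to the distance bound; adding 2 ensures λ >
    -- 1.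
    · refine hγ.not_hasVisibility (lam := r⁻¹ / (m * b) + 2) hopen ha le_rfl hr
        hb ht₀ (by positivity) le_rfl hm hk (fun d hd => ?_) (hvis _ ?_)
      · have h1 : (r⁻¹ / (m * b) + 2) * (m * (b * d)) = r⁻¹ * d + 2 * (m * (b * d)) := by
          field_simp
        have h2 : 0 ≤ m * (b * d) := by have := hd.1; positivity
        linarith
      · have : 0 < r⁻¹ / (m * b) := by positivity
        linarith
  -- Off Ω the distance is 0 < e^{-c}, so the sublevel set is closed in the whole space.
  · have heq : {z ∈ Ω | -Real.log (infDist z Ωᶜ) ≤ c} = {z | Real.exp (-c) ≤ infDist z Ωᶜ} := by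
      ext z
      constructor
      · rintro ⟨hz, hzc⟩
        change Real.exp (-c) ≤ infDist z Ωᶜ
        rw [← Real.le_log_iff_exp_le ((hpos z).1 hz)]
        linarith
      · intro hz
        have hz0 : 0 < infDist z Ωᶜ := (Real.exp_pos _).trans_le hz
        refine ⟨(hpos z).2 hz0, ?_⟩
        have := (Real.le_log_iff_exp_le hz0).2 hz
        linarith
    refine Metric.isCompact_of_isClosed_isBounded ?_ (hbdd.subset fun z hz => hz.1)
    rw [heq]
    exact isClosed_le continuous_const (continuous_infDist_pt _)
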